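/- For an integer $n\ge 1$ let $\mathcal B^n(r)=\{x\in\mathbb R^n:\|x\|_2\le r\}$. Let $L\ge 2$ be an integer and let $P,N>0$. The squared Chebyshev radius of points $x_1,\dots,x_L\in\mathbb R^n$ is $\mathrm{rad}^2(x_1,\dots,x_L)=\min_{y\in\mathbb R^n}\max_{1\le i\le L}\|x_i-y\|_2^2$. A set $\mathcal C\subseteq\mathcal B^n(\sqrt{nP})$ is called $(P,N,L-1)$-list-decodable if $\mathrm{rad}^2_L(\mathcal C)>nN$, where $\mathrm{rad}^2_L(\mathcal C)$ denotes the infimum of $\mathrm{rad}^2(x_1,\dots,x_L)$ over all $L$-element subsets $\{x_1,\dots,x_L\}$ of $\mathcal C$ (with the value $+\infty$ if $|\mathcal C|<L$); equivalently, every closed ball of radius $\sqrt{nN}$ in $\mathbb R^n$ contains at most $L-1$ points of $\mathcal C$. The rate of $\mathcal C$ is $R(\mathcal C)=\frac1n\ln|\mathcal C|$, and the $(P,N,L-1)$-list-decoding capacity is $$C_{L-1}(P,N)=\limsup_{n\to\infty}\ \sup\bigl\{R(\mathcal C):\mathcal C\subseteq\mathcal B^n(\sqrt{nP})\text{ is }(P,N,L-1)\text{-list-decodable}\bigr\}.$$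 **Theorem.** Let $L\ge 2$ be an integer and let $N,P>0$ satisfy $\frac NP\le\frac{L-1}{L}$. Then $$C_{L-1}(P,N)\le\frac12\ln\frac{(L-1)P}{LN}.$$ -/

import Mathlib

namespace MultiplePacking

open Metric Filter

/-- The squared Chebyshev radius of a finite list of points of `ℝⁿ`: the squared radius of the
smallest ball that contains all of them. -/
noncomputable def radSq {n : ℕ} (S : Finset (EuclideanSpace ℝ (Fin n))) : EReal :=
  ⨅ y : EuclideanSpace ℝ (Fin n), ⨆ x ∈ S, ((‖x - y‖ ^ 2 : ℝ) : EReal)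

/-- The squared `(L-1)`-list-decoding radius of a code: the least squared Chebyshev radius of a
list of `L` distinct codewords (`⊤` if the code has fewer than `L` codewords). -/
noncomputable def listRadSq {n : ℕ} (L : ℕ) (C : Set (EuclideanSpace ℝ (Fin n))) : EReal :=
  ⨅ S : Finset (EuclideanSpace ℝ (Fin n)), ⨅ _ : (S : Set (EuclideanSpace ℝ (Fin n))) ⊆ C,
    ⨅ _ : S.card = L, radSq S

/-- `C` lies in the ball of radius `√(nP)` and is a `(P, N, L-1)`-list-decodable code (multiple
packing): its squared `(L-1)`-list-decoding radius exceeds `nN`. -/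
def IsListDecodable {n : ℕ} (L : ℕ) (P N : ℝ) (C : Set (EuclideanSpace ℝ (Fin n))) : Prop :=
  C ⊆ closedBall 0 (√(n * P)) ∧ ((n * N : ℝ) : EReal) < listRadSq L C

/-- The rate `(1/n) ln |C|` of a code, with value `⊤` for an infinite code (in dimension
`n ≥ 1`) and `⊥` for the empty code. -/
noncomputable def rate {n : ℕ} (C : Set (EuclideanSpace ℝ (Fin n))) : EReal :=
  ENNReal.log (C.encard : ENNReal) / (n : EReal)

/-- The `(P, N, L-1)`-list-decoding capacity `C_{L-1}(P, N)`: the limit superior, as the dimension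
tends to infinity, of the largest rate of a `(P, N, L-1)`-list-decodable code. -/
noncomputable def capacity (L : ℕ) (P N : ℝ) : EReal :=
  limsup (fun n : ℕ => ⨆ C : Set (EuclideanSpace ℝ (Fin n)), ⨆ _ : IsListDecodable L P N C, rate C)
    atTop

/-- The equivalent definition of list-decodability: every ball of radius `√(nN)` contains at most
`L-1` codewords. -/
theorem isListDecodable_iff {n : ℕ} (hn : 0 < n) {L : ℕ} (hL : 2 ≤ L) {P N : ℝ} (hN : 0 < N)
    (C : Set (EuclideanSpace ℝ (Fin n))) :
    IsListDecodable L P N C ↔ C ⊆ closedBall 0 (√(n * P)) ∧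
      ∀ y, (C ∩ closedBall y (√(n * N))).encard ≤ ((L - 1 : ℕ) : ℕ∞) := by
  have hn' : (0 : ℝ) < n := by exact_mod_cast hn
  have hnN : (0 : ℝ) < n * N := by positivity
  unfold IsListDecodable
  refine and_congr_right fun hC => ⟨fun h y => ?_, fun h => ?_⟩
  · by_contra hlt
    push Not at hlt
    have hle : (L : ℕ∞) ≤ (C ∩ closedBall y (√(n * N))).encard := by
      have := Order.add_one_le_of_lt hlt
      refine le_trans ?_ this
      norm_cast
      omega
    obtain ⟨t, ht, htc⟩ := Set.exists_subset_encard_eq hle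
    have htf : t.Finite := Set.finite_of_encard_eq_coe htc
    refine absurd h (not_lt.mpr ?_)
    refine (iInf_le_of_le htf.toFinset <| iInf_le_of_le ?_ <| iInf_le_of_le ?_ <|
      iInf_le_of_le y <| iSup₂_le ?_)
    · intro x hx
      exact (ht (htf.mem_toFinset.mp hx)).1
    · rw [htf.encard_eq_coe_toFinset_card] at htc
      exact_mod_cast htc
    · intro x hx
      have hx' := (ht (htf.mem_toFinset.mp hx)).2
      rw [mem_closedBall, dist_eq_norm] at hx'
      rw [EReal.coe_le_coe_iff, ← Real.sq_sqrt hnN.le]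
      gcongr
  · have hfin : C.Finite := by
      have hK := isCompact_closedBall (0 : EuclideanSpace ℝ (Fin n)) (√(n * P))
      obtain ⟨t, -, htf, ht⟩ := hK.finite_cover_balls (Real.sqrt_pos.mpr hnN)
      refine (htf.biUnion (t := fun y => C ∩ closedBall y (√(n * N))) fun y _ => ?_).subset ?_
      · exact Set.finite_of_encard_le_coe (h y)
      · intro x hx
        obtain ⟨y, hy, hxy⟩ := Set.mem_iUnion₂.mp (ht (hC hx))
        exact Set.mem_iUnion₂.mpr ⟨y, hy, hx, ball_subset_closedBall hxy⟩
    have key : ∀ S : Finset (EuclideanSpace ℝ (Fin n)), (S : Set _) ⊆ C → S.card = L →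
        ((n * N : ℝ) : EReal) < radSq S := by
      intro S hS hSL
      by_contra hle
      push Not at hle
      have hSne : S.Nonempty := Finset.card_pos.mp (by omega)
      obtain ⟨x₀, hx₀⟩ := hSne
      let K : ℕ → Set (EuclideanSpace ℝ (Fin n)) := fun k =>
        ⋂ x ∈ S, closedBall x (√(n * N + 1 / ((k : ℝ) + 1)))
      have hKc : ∀ k, IsClosed (K k) := fun k =>
        isClosed_biInter fun x _ => isClosed_closedBall
      have hKn : ∀ k, (K k).Nonempty := by
        intro k
        have hk : (0 : ℝ) < 1 / ((k : ℝ) + 1) := by positivity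
        have hlt : radSq S < ((n * N + 1 / ((k : ℝ) + 1) : ℝ) : EReal) :=
          lt_of_le_of_lt hle (by rw [EReal.coe_lt_coe_iff]; linarith)
        obtain ⟨y, hy⟩ := iInf_lt_iff.mp hlt
        refine ⟨y, Set.mem_iInter₂.mpr fun x hx => ?_⟩
        have h1 := (le_iSup₂ (f := fun x (_ : x ∈ S) => ((‖x - y‖ ^ 2 : ℝ) : EReal)) x hx).trans hy.le
        rw [EReal.coe_le_coe_iff] at h1
        rw [mem_closedBall, dist_comm, dist_eq_norm]
        exact Real.le_sqrt_of_sq_le h1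
      have hKm : ∀ k, K (k + 1) ⊆ K k := by
        intro k
        refine Set.iInter₂_mono fun x _ => closedBall_subset_closedBall (Real.sqrt_le_sqrt ?_)
        push_cast
        gcongr
        linarith
      have hK0 : IsCompact (K 0) :=
        (isCompact_closedBall x₀ _).of_isClosed_subset (hKc 0) (Set.biInter_subset_of_mem hx₀)
      obtain ⟨y, hy⟩ := IsCompact.nonempty_iInter_of_sequence_nonempty_isCompact_isClosed
        K hKm hKn hK0 hKc
      have hyS : ∀ x ∈ S, x ∈ closedBall y (√(n * N)) := by
        intro x hx
        rw [mem_closedBall, dist_eq_norm]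
        refine Real.le_sqrt_of_sq_le (le_of_forall_pos_le_add fun ε hε => ?_)
        obtain ⟨k, hk⟩ := exists_nat_one_div_lt hε
        have h1 := Set.mem_iInter₂.mp (Set.mem_iInter.mp hy k) x hx
        have hp : (0 : ℝ) < 1 / ((k : ℝ) + 1) := by positivity
        rw [mem_closedBall, dist_comm, dist_eq_norm,
          Real.le_sqrt (norm_nonneg _) (by linarith)] at h1
        linarith
      have h2 : (S : Set _).encard ≤ (C ∩ closedBall y (√(n * N))).encard :=
        Set.encard_le_encard fun x hx => ⟨hS hx, hyS x hx⟩
      have h3 := h2.trans (h y)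
      rw [Set.encard_coe_eq_coe_finsetCard, hSL] at h3
      have : L ≤ L - 1 := by exact_mod_cast h3
      omega
    by_contra hle
    push Not at hle
    have hT : {S : Finset (EuclideanSpace ℝ (Fin n)) | (S : Set _) ⊆ C ∧ S.card = L}.Finite :=
      (hfin.finite_subsets.preimage Finset.coe_injective.injOn).subset fun S hS => hS.1
    rcases Set.eq_empty_or_nonempty
      {S : Finset (EuclideanSpace ℝ (Fin n)) | (S : Set _) ⊆ C ∧ S.card = L} with he | hne
    · have : listRadSq L C = ⊤ := by
        unfold listRadSq
        simp only [iInf_eq_top]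
        intro S h1 h2
        exact absurd (show S ∈ {S : Finset (EuclideanSpace ℝ (Fin n)) |
          (S : Set _) ⊆ C ∧ S.card = L} from ⟨h1, h2⟩) (by simp [he])
      rw [this] at hle
      exact absurd hle (not_le.mpr (EReal.coe_lt_top _))
    · obtain ⟨S, hS, hmin⟩ := Set.exists_min_image _ radSq hT hne
      refine absurd (lt_of_lt_of_le (key S hS.1 hS.2) ?_) (not_lt.mpr hle)
      exact le_iInf fun S' => le_iInf fun h1 => le_iInf fun h2 => hmin S' ⟨h1, h2⟩

end MultiplePacking

/-! The bound combines a Plotkin-type bound that does not depend on the dimension with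
Elias–Bassalygo averaging over the small balls centered in the ball of radius `√(nP)`.

*Plotkin.* Let `g = (L - 1) / L` and suppose that a ball of squared radius `nQ`, where `g * Q < N`,
contains many codewords. If some cap of the ball contains a fixed proportion of them, moving the
center towards the cap lowers the squared radius of the ball around these codewords by a fixed
proportion of `nQ`, so this can happen only boundedly often. Otherwise each codeword, seen from the
center, is almost orthogonal to most others, and a greedy choice yields `L` codewords that are
pairwise almost orthogonal. They lie within squared distance about `g * nQ < nN` of their average,
contradicting list-decodability. So each ball of squared radius `nQ` contains boundedly many
codewords.

*Averaging.* Put `q = Q / P` and `A = nP`. A ball of squared radius `qA` around a codeword `x` meets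
the ball of squared radius `(1 - q)A` around `0` in a lens around `(1 - q)x`. The lens contains the
part near the hyperplane orthogonal to `x` of a ball of squared radius slightly below `(1 - q)qA`,
and hence up to a bounded factor a proportion slightly below `√q ^ n` of the ball around `0`. By the
Plotkin bound the lenses cover each point boundedly often, so there are at most about `√(P / Q) ^ n`
codewords. Finally `Q` tends to `N / g`.
-/

namespace MultiplePacking

open Metric Filter MeasureTheory Module
open scoped Finset ENNReal Topology

theorem exists_subset_card_eq_pairwise {α : Type*} {r : α → α → Prop} [DecidableRel r]
    [Std.Symm r] {S : Finset α} {d k : ℕ} (hd₀ : 0 < d) (hd : ∀ x ∈ S, #{y ∈ S | ¬ r x y} < d)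
    (hS : k * d ≤ #S) : ∃ T ⊆ S, #T = k ∧ (T : Set α).Pairwise r := by
  classical
  induction k generalizing S with
  | zero => exact ⟨∅, by simp⟩
  | succ k ih =>
    obtain ⟨x, hx⟩ : S.Nonempty := Finset.card_pos.mp (by lia)
    set S' : Finset α := {y ∈ S | r x y}.erase x
    have hS'S : S' ⊆ S := (Finset.erase_subset _ _).trans (Finset.filter_subset _ _)
    have hS' : k * d ≤ #S' := by
      have hsplit := S.card_filter_add_card_filter_not (r x)
      have herase : #{y ∈ S | r x y} - 1 ≤ #S' := Finset.pred_card_le_card_erase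
      have hbad := hd x hx
      lia
    obtain ⟨T, hTS', hT, hTr⟩ := ih (fun y hy => (Finset.card_le_card
      (Finset.filter_subset_filter _ hS'S)).trans_lt (hd y (hS'S hy))) hS'
    have hxT : x ∉ T := fun h => Finset.notMem_erase x _ (hTS' h)
    refine ⟨insert x T, Finset.insert_subset hx (hTS'.trans hS'S),
      by rw [Finset.card_insert_of_notMem hxT, hT], ?_⟩
    rw [Finset.coe_insert, Set.pairwise_insert_of_symm]
    exact ⟨hTr, fun y hy _ => (Finset.mem_filter.mp (Finset.mem_of_mem_erase (hTS' hy))).2⟩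

section Plotkin

variable {E : Type*} [NormedAddCommGroup E] [InnerProductSpace ℝ E]

theorem norm_sub_smul_sq_le {u v : E} {a Q δ : ℝ} (hδ : 0 ≤ δ) (hQ : 0 < Q) (hu : ‖u‖ ^ 2 ≤ Q)
    (hv : ‖v‖ ^ 2 ≤ a) (huv : δ ≤ inner ℝ u v) : ‖v - (δ / Q) • u‖ ^ 2 ≤ a - δ ^ 2 / Q := by
  have ht : 0 ≤ δ / Q := by positivity
  calc ‖v - (δ / Q) • u‖ ^ 2
      = ‖v‖ ^ 2 - 2 * (δ / Q) * inner ℝ u v + (δ / Q) ^ 2 * ‖u‖ ^ 2 := by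
        rw [norm_sub_sq_real, inner_smul_right, real_inner_comm, norm_smul, mul_pow,
          Real.norm_of_nonneg ht]
        ring
    _ ≤ a - 2 * (δ / Q) * δ + (δ / Q) ^ 2 * Q := by gcongr
    _ = a - δ ^ 2 / Q := by field_simp; ring

theorem exists_subset_pairwise_abs_inner_le {Q δ : ℝ} (hQ : 0 < Q) (hδ : 0 < δ) {k : ℕ}
    (hk : 0 < k) {j : ℕ} {S : Finset E} {c : E} {a : ℝ} (haQ : a ≤ Q) (haj : a < j * (δ ^ 2 / Q))
    (hS : (2 * k) ^ j ≤ #S) (hSc : ∀ x ∈ S, ‖x - c‖ ^ 2 ≤ a) :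
    ∃ c' : E, ∃ T ⊆ S, #T = k ∧ (∀ x ∈ T, ‖x - c'‖ ^ 2 ≤ Q) ∧
      (T : Set E).Pairwise fun x y => |inner ℝ (x - c') (y - c')| ≤ δ := by
  classical
  induction j generalizing S c a with
  | zero =>
    obtain ⟨x, hx⟩ : S.Nonempty := Finset.card_pos.mp (by lia)
    have := hSc x hx
    norm_num at haj
    nlinarith [sq_nonneg ‖x - c‖]
  | succ j ih =>
    set m : ℕ := (2 * k) ^ j
    by_cases hcap : ∃ u : E, ‖u‖ ^ 2 ≤ Q ∧ m ≤ #{x ∈ S | δ < inner ℝ u (x - c)}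
    · -- Moving the center towards the points of the cap shrinks the radius.
      obtain ⟨u, hu, hm⟩ := hcap
      have hrecentered : ∀ x ∈ S.filter fun x => δ < inner ℝ u (x - c),
          ‖x - (c + (δ / Q) • u)‖ ^ 2 ≤ a - δ ^ 2 / Q := fun x hx => by
        obtain ⟨hxS, hux⟩ := Finset.mem_filter.mp hx
        rw [← sub_sub]
        exact norm_sub_smul_sq_le hδ.le hQ hu (hSc x hxS) hux.le
      have hstep : 0 ≤ δ ^ 2 / Q := by positivity
      push_cast at haj
      obtain ⟨c', T, hT, h⟩ := ih (by linarith) (by linarith) hm hrecentered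
      exact ⟨c', T, hT.trans (Finset.filter_subset _ _), h⟩
    · push Not at hcap
      have : Std.Symm fun x y : E => |inner ℝ (x - c) (y - c)| ≤ δ :=
        ⟨fun x y h => by rwa [real_inner_comm]⟩
      have hfew : ∀ x ∈ S, #{y ∈ S | ¬ |inner ℝ (x - c) (y - c)| ≤ δ} < 2 * m := fun x hx => by
        have hsub : {y ∈ S | ¬ |inner ℝ (x - c) (y - c)| ≤ δ} ⊆
            {y ∈ S | δ < inner ℝ (x - c) (y - c)} ∪ {y ∈ S | δ < inner ℝ (c - x) (y - c)} := by
          intro y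
          simp only [← Finset.filter_or, Finset.mem_filter, not_le, lt_abs, ← neg_sub x c,
            inner_neg_left, imp_self]
        have hxc := (hSc x hx).trans haQ
        calc _ ≤ _ := (Finset.card_le_card hsub).trans (Finset.card_union_le _ _)
          _ < m + m := add_lt_add (hcap _ hxc) (hcap _ (norm_sub_rev x c ▸ hxc))
          _ = 2 * m := (two_mul m).symm
      obtain ⟨T, hTS, hT, horth⟩ := exists_subset_card_eq_pairwise (k := k) (by positivity) hfew
        (by rw [← mul_assoc, mul_comm k, ← pow_succ']; exact hS)
      exact ⟨c, T, hTS, hT, fun x hx => (hSc x (hTS hx)).trans haQ, horth⟩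

theorem norm_sum_sq_le {ι : Type*} {T : Finset ι} {v : ι → E} {a δ : ℝ}
    (hv : ∀ i ∈ T, ‖v i‖ ^ 2 ≤ a) (hvv : (T : Set ι).Pairwise fun i j => inner ℝ (v i) (v j) ≤ δ) :
    ‖∑ i ∈ T, v i‖ ^ 2 ≤ #T * (a + (#T - 1) * δ) := by
  classical
  rw [← real_inner_self_eq_norm_sq, sum_inner, ← nsmul_eq_mul]
  refine Finset.sum_le_card_nsmul _ _ _ fun i hi => ?_
  have hoff : ∑ j ∈ T.erase i, inner ℝ (v i) (v j) ≤ (#T - 1) * δ := by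
    rw [← Finset.cast_card_erase_of_mem hi, ← nsmul_eq_mul]
    exact Finset.sum_le_card_nsmul _ _ _ fun j hj =>
      hvv hi (Finset.mem_of_mem_erase hj) (Finset.ne_of_mem_erase hj).symm
  rw [inner_sum, ← Finset.add_sum_erase T _ hi, real_inner_self_eq_norm_sq]
  exact add_le_add (hv i hi) hoff

theorem norm_sub_average_sq_le {ι : Type*} {T : Finset ι} {v : ι → E} {a δ : ℝ} (hδ : 0 ≤ δ)
    (hv : ∀ i ∈ T, ‖v i‖ ^ 2 ≤ a)
    (hvv : (T : Set ι).Pairwise fun i j => |inner ℝ (v i) (v j)| ≤ δ) {i : ι} (hi : i ∈ T) :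
    ‖v i - (#T : ℝ)⁻¹ • ∑ j ∈ T, v j‖ ^ 2 ≤ ((#T : ℝ) - 1) / #T * (a + 3 * δ) := by
  classical
  set w : E := ∑ j ∈ T.erase i, v j
  set l : ℝ := (#T : ℝ) with hl
  have hl₁ : 1 ≤ l := Nat.one_le_cast.mpr (Finset.card_pos.mpr ⟨i, hi⟩)
  have hcard : (#(T.erase i) : ℝ) = l - 1 := Finset.cast_card_erase_of_mem hi
  have hw : ‖w‖ ^ 2 ≤ (l - 1) * (a + (l - 2) * δ) := by
    refine (norm_sum_sq_le (fun j hj => hv j (Finset.mem_of_mem_erase hj))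
      fun j hj j' hj' hjj' => (le_abs_self _).trans (hvv (Finset.mem_of_mem_erase hj)
        (Finset.mem_of_mem_erase hj') hjj')).trans_eq ?_
    rw [hcard]
    ring
  have hvw : -inner ℝ (v i) w ≤ (l - 1) * δ := by
    rw [inner_sum, ← Finset.sum_neg_distrib, ← hcard, ← nsmul_eq_mul]
    exact Finset.sum_le_card_nsmul _ _ _ fun j hj => (neg_le_abs _).trans
      (hvv hi (Finset.mem_of_mem_erase hj) (Finset.ne_of_mem_erase hj).symm)
  have hsub : v i - l⁻¹ • ∑ j ∈ T, v j = l⁻¹ • ((l - 1) • v i - w) := by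
    rw [← Finset.add_sum_erase T v hi, sub_smul, smul_sub, smul_sub, smul_add,
      inv_smul_smul₀ (by positivity), one_smul, sub_sub]
  calc ‖v i - l⁻¹ • ∑ j ∈ T, v j‖ ^ 2
      = ((l - 1) ^ 2 * ‖v i‖ ^ 2 + 2 * (l - 1) * -inner ℝ (v i) w + ‖w‖ ^ 2) / l ^ 2 := by
        rw [hsub, norm_smul, mul_pow, norm_sub_sq_real, norm_smul, mul_pow, real_inner_smul_left,
          norm_inv, Real.norm_eq_abs, Real.norm_eq_abs, inv_pow, sq_abs, sq_abs]
        ring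
    _ ≤ ((l - 1) ^ 2 * a + 2 * (l - 1) * ((l - 1) * δ) + (l - 1) * (a + (l - 2) * δ)) / l ^ 2 := by
        have hl₀ : 0 ≤ l - 1 := sub_nonneg.mpr hl₁
        gcongr
        exact hv i hi
    _ = (l - 1) / l * (a + 3 * δ) - 4 * (l - 1) * δ / l ^ 2 := by field_simp; ring
    _ ≤ (l - 1) / l * (a + 3 * δ) :=
        sub_le_self _ (by have := sub_nonneg.mpr hl₁; positivity)

theorem card_lt_of_forall_card_filter_norm_sub_sq_le_lt {S : Finset E} {c : E} {a b δ : ℝ}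
    {L j : ℕ} (ha : 0 < a) (hδ : 0 < δ) (hj : a < j * (δ ^ 2 / a))
    (hb : ((L : ℝ) - 1) / L * (a + 3 * δ) ≤ b) (hSc : ∀ x ∈ S, ‖x - c‖ ^ 2 ≤ a)
    (hS : ∀ y, #{x ∈ S | ‖x - y‖ ^ 2 ≤ b} < L) : #S < (2 * L) ^ j := by
  by_contra! hcard
  obtain ⟨c', T, hTS, rfl, hTc, horth⟩ :=
    exists_subset_pairwise_abs_inner_le ha hδ (Nat.zero_lt_of_lt (hS c)) le_rfl hj hcard hSc
  refine (hS (c' + (#T : ℝ)⁻¹ • ∑ x ∈ T, (x - c'))).not_ge (Finset.card_le_card fun x hx => ?_)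
  rw [Finset.mem_filter, ← sub_sub]
  exact ⟨hTS hx, (norm_sub_average_sq_le hδ.le hTc horth hx).trans hb⟩

end Plotkin

theorem exists_forall_card_le_of_card_filter_norm_sub_sq_le_lt {L : ℕ} (hL : 0 < L) {N Q : ℝ}
    (hQ : 0 < Q) (hN : ((L : ℝ) - 1) / L * Q < N) :
    ∃ K : ℕ, 0 < K ∧ ∀ {E : Type*} [NormedAddCommGroup E] [InnerProductSpace ℝ E] {S : Finset E}
      {c : E} {t : ℝ}, 0 < t → (∀ x ∈ S, ‖x - c‖ ^ 2 ≤ t * Q) →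
        (∀ y, #{x ∈ S | ‖x - y‖ ^ 2 ≤ t * N} < L) → #S ≤ K := by
  set g : ℝ := ((L : ℝ) - 1) / L
  have hg : g ≤ 1 := div_le_one_of_le₀ (sub_le_self _ zero_le_one) L.cast_nonneg
  obtain ⟨δ, hδN⟩ : ∃ δ, g * Q + 3 * δ = N := ⟨(N - g * Q) / 3, by ring⟩
  have hδ : 0 < δ := by linarith
  obtain ⟨j, hj⟩ := exists_nat_gt (Q / (δ ^ 2 / Q))
  rw [div_lt_iff₀ (by positivity)] at hj
  refine ⟨(2 * L) ^ j, by positivity, fun {E} _ _ S c t ht hSc hS => ?_⟩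
  have htj : t * Q < j * ((t * δ) ^ 2 / (t * Q)) := calc
    t * Q < t * (j * (δ ^ 2 / Q)) := by gcongr
    _ = j * ((t * δ) ^ 2 / (t * Q)) := by field_simp
  have htN : g * (t * Q + 3 * (t * δ)) ≤ t * N := calc
    g * (t * Q + 3 * (t * δ)) = t * (g * Q + g * (3 * δ)) := by ring
    _ ≤ t * (g * Q + 3 * δ) := by
      have : g * (3 * δ) ≤ 3 * δ := mul_le_of_le_one_left (by positivity) hg
      gcongr
    _ = t * N := by rw [hδN]
  exact (card_lt_of_forall_card_filter_norm_sub_sq_le_lt (by positivity) (by positivity) htj htN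
    hSc hS).le

section Lens

variable {E : Type*} [NormedAddCommGroup E] [InnerProductSpace ℝ E]

theorem exists_int_abs_sub_mul_le {a τ : ℝ} (hτ : 0 < τ) {m : ℕ} (ha : |a| ≤ m * τ) :
    ∃ k : ℤ, |k| ≤ m ∧ |a - k * τ| ≤ τ ∧ |a - k * τ| ≤ |a| := by
  have hscale (z : ℝ) : |a - z * τ| = |a / τ - z| * τ := by
    rw [← abs_of_pos hτ, ← abs_mul, abs_of_pos hτ, sub_mul, div_mul_cancel₀ a hτ.ne']
  have hround := abs_sub_round (a / τ)
  refine ⟨round (a / τ), ?_, ?_, ?_⟩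
  · have ham : |a / τ| ≤ m := by rwa [abs_div, abs_of_pos hτ, div_le_iff₀ hτ]
    have htriangle := abs_sub_abs_le_abs_sub (round (a / τ) : ℝ) (a / τ)
    rw [abs_sub_comm] at htriangle
    have : |(round (a / τ) : ℝ)| < m + 1 := by linarith
    exact Int.lt_add_one_iff.mp (by exact_mod_cast this)
  · rw [hscale]
    exact mul_le_of_le_one_left hτ.le (by linarith)
  · have hround₀ := round_le (a / τ) 0
    calc |a - round (a / τ) * τ| = |a / τ - round (a / τ)| * τ := hscale _
      _ ≤ |a / τ - (0 : ℤ)| * τ := by gcongr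
      _ = |a| := by rw [← hscale]; simp

theorem norm_sub_div_smul_le {x w : E} {t : ℝ} (ht : |inner ℝ x w - t| ≤ |inner ℝ x w|) :
    ‖w - (t / ‖x‖ ^ 2) • x‖ ≤ ‖w‖ := by
  rcases eq_or_ne x 0 with rfl | hx
  · simp
  refine le_of_sq_le_sq ?_ (norm_nonneg w)
  calc ‖w - (t / ‖x‖ ^ 2) • x‖ ^ 2
      = ‖w‖ ^ 2 + ((inner ℝ x w - t) ^ 2 - inner ℝ x w ^ 2) / ‖x‖ ^ 2 := by
        rw [norm_sub_sq_real, real_inner_smul_right, real_inner_comm, norm_smul, mul_pow,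
          Real.norm_eq_abs, sq_abs]
        field_simp
        ring
    _ ≤ ‖w‖ ^ 2 := add_le_of_nonpos_right
        (div_nonpos_of_nonpos_of_nonneg (sub_nonpos.mpr (sq_le_sq.mpr ht)) (sq_nonneg _))

theorem measure_closedBall_le_mul_slab [MeasurableSpace E] [BorelSpace E] (μ : Measure E)
    [μ.IsAddRightInvariant] (x : E) {ρ τ : ℝ} (hτ : 0 < τ) {m : ℕ} (hm : ‖x‖ * ρ ≤ m * τ) :
    μ (closedBall 0 ρ) ≤ (2 * m + 1) * μ (closedBall 0 ρ ∩ {w | |inner ℝ x w| ≤ τ}) := by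
  rcases eq_or_ne x 0 with rfl | hx
  · have hslab : {w : E | |inner ℝ (0 : E) w| ≤ τ} = Set.univ := by simp [hτ.le]
    rw [hslab, Set.inter_univ]
    exact le_mul_of_one_le_left zero_le le_add_self
  -- Shifting `w` along `x` rounds `⟪x, w⟫` to within `τ` of `0` and does not increase `‖w‖`.
  have hcover : closedBall 0 ρ ⊆ ⋃ k ∈ Finset.Icc (-(m : ℤ)) m,
      (fun w => w - (k * τ / ‖x‖ ^ 2) • x) ⁻¹' (closedBall 0 ρ ∩ {w | |inner ℝ x w| ≤ τ}) := by
    intro w hw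
    rw [mem_closedBall_zero_iff] at hw
    obtain ⟨k, hkm, hkτ, hk⟩ := exists_int_abs_sub_mul_le hτ
      ((abs_real_inner_le_norm x w).trans ((mul_le_mul_of_nonneg_left hw (norm_nonneg x)).trans hm))
    refine Set.mem_biUnion (Finset.mem_Icc.mpr (abs_le.mp hkm))
      ⟨mem_closedBall_zero_iff.mpr ((norm_sub_div_smul_le hk).trans hw), ?_⟩
    have hinner : inner ℝ x (w - (k * τ / ‖x‖ ^ 2) • x) = inner ℝ x w - k * τ := by
      rw [inner_sub_right, real_inner_smul_right, real_inner_self_eq_norm_sq,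
        div_mul_cancel₀ _ (by positivity)]
    rwa [Set.mem_ofPred_eq, hinner]
  refine (measure_mono hcover).trans ((measure_biUnion_finset_le _ _).trans_eq ?_)
  simp only [sub_eq_add_neg, measure_preimage_add_right, Finset.sum_const, Int.card_Icc,
    nsmul_eq_mul]
  congr 1
  norm_cast
  lia

theorem norm_smul_add_sq_le_and_norm_smul_add_sub_sq_le {x w : E} {A p q : ℝ} (hp : 0 ≤ p)
    (hq : 0 ≤ q) (hpq : p + q = 1) (hx : ‖x‖ ^ 2 ≤ A)
    (hw : ‖w‖ ^ 2 + 2 * |inner ℝ x w| ≤ p * q * A) :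
    ‖p • x + w‖ ^ 2 ≤ p * A ∧ ‖p • x + w - x‖ ^ 2 ≤ q * A := by
  have hbound {t : ℝ} (ht : |t| ≤ 1) : ‖t • x + w‖ ^ 2 ≤ t ^ 2 * A + p * q * A := by
    have htx : t * inner ℝ x w ≤ |inner ℝ x w| := (le_abs_self _).trans
      (abs_mul t _ ▸ mul_le_of_le_one_left (abs_nonneg _) ht)
    have htA : t ^ 2 * ‖x‖ ^ 2 ≤ t ^ 2 * A := by gcongr
    rw [norm_add_sq_real, real_inner_smul_left, norm_smul, mul_pow, Real.norm_eq_abs, sq_abs]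
    linarith
  obtain rfl : p = 1 - q := by linarith
  constructor
  · refine (hbound (abs_le.mpr ⟨by linarith, by linarith⟩)).trans_eq ?_
    ring
  · have hsub : (1 - q) • x + w - x = (-q) • x + w := by module
    rw [hsub]
    refine (hbound (abs_le.mpr ⟨by linarith, by linarith⟩)).trans_eq ?_
    ring

theorem measure_closedBall_le_mul_lens [MeasurableSpace E] [BorelSpace E] (μ : Measure E)
    [μ.IsAddRightInvariant] {x : E} {A q θ : ℝ} (hA : 0 < A) (hq₀ : 0 < q) (hq₁ : q < 1)
    (hθ₀ : 0 ≤ θ) (hθ₁ : θ < 1) {m : ℕ} (hm : 4 * θ ≤ m ^ 2 * ((1 - θ) ^ 2 * ((1 - q) * q)))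
    (hx : ‖x‖ ^ 2 ≤ A) :
    μ (closedBall 0 √(θ * ((1 - q) * q * A))) ≤
      (2 * m + 1) * μ (closedBall x √(q * A) ∩ closedBall 0 √((1 - q) * A)) := by
  set B : ℝ := (1 - q) * q * A
  set τ : ℝ := (1 - θ) * B / 2
  have hp₀ : 0 < 1 - q := sub_pos.mpr hq₁
  have : 0 < B := by positivity
  have hτ : 0 < τ := by have := sub_pos.mpr hθ₁; positivity
  have hmτ : ‖x‖ * √(θ * B) ≤ m * τ := by
    refine le_of_sq_le_sq ?_ (by positivity)
    rw [mul_pow, Real.sq_sqrt (by positivity)]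
    calc ‖x‖ ^ 2 * (θ * B) ≤ A * (θ * B) := by gcongr
      _ = 4 * θ * (A * B / 4) := by ring
      _ ≤ m ^ 2 * ((1 - θ) ^ 2 * ((1 - q) * q)) * (A * B / 4) := by gcongr
      _ = (m * τ) ^ 2 := by ring
  have hsub : closedBall 0 √(θ * B) ∩ {w | |inner ℝ x w| ≤ τ} ⊆
      (fun w => w + (1 - q) • x) ⁻¹' (closedBall x √(q * A) ∩ closedBall 0 √((1 - q) * A)) := by
    rintro w ⟨hw, hxw⟩
    rw [mem_closedBall_zero_iff, Real.le_sqrt (norm_nonneg w) (by positivity)] at hw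
    have hθτ : θ * B + 2 * τ = B := by ring
    obtain ⟨h₀, h₁⟩ := norm_smul_add_sq_le_and_norm_smul_add_sub_sq_le hp₀.le hq₀.le
      (sub_add_cancel 1 q) hx
      (hθτ ▸ add_le_add hw (mul_le_mul_of_nonneg_left hxw zero_le_two))
    rw [Set.mem_preimage, add_comm w]
    exact ⟨mem_closedBall_iff_norm.mpr (Real.le_sqrt_of_sq_le h₁),
      mem_closedBall_zero_iff.mpr (Real.le_sqrt_of_sq_le h₀)⟩
  calc μ (closedBall 0 √(θ * B))
      ≤ (2 * m + 1) * μ (closedBall 0 √(θ * B) ∩ {w | |inner ℝ x w| ≤ τ}) :=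
        measure_closedBall_le_mul_slab μ x hτ hmτ
    _ ≤ (2 * m + 1) * μ (closedBall x √(q * A) ∩ closedBall 0 √((1 - q) * A)) := by
        rw [← measure_preimage_add_right μ ((1 - q) • x) (closedBall x _ ∩ _)]
        gcongr

end Lens

theorem sum_measure_le_mul_measure_univ {ι α : Type*} [MeasurableSpace α] (μ : Measure α)
    {F : Finset ι} {s : ι → Set α} [∀ y, DecidablePred fun i => y ∈ s i] {K : ℕ}
    (hs : ∀ i ∈ F, MeasurableSet (s i)) (hK : ∀ y, #{i ∈ F | y ∈ s i} ≤ K) :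
    ∑ i ∈ F, μ (s i) ≤ K * μ Set.univ := by
  calc ∑ i ∈ F, μ (s i) = ∑ i ∈ F, ∫⁻ y, (s i).indicator 1 y ∂μ :=
        Finset.sum_congr rfl fun i hi => (lintegral_indicator_one (hs i hi)).symm
    _ = ∫⁻ y, ∑ i ∈ F, (s i).indicator 1 y ∂μ :=
        (lintegral_finsetSum' _ fun i hi => (aemeasurable_one.indicator (hs i hi))).symm
    _ ≤ ∫⁻ _, K ∂μ := by
        refine lintegral_mono fun y => ?_
        simp only [Set.indicator_apply, Pi.one_apply, Finset.sum_boole]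
        exact Nat.cast_le.mpr (hK y)
    _ = K * μ Set.univ := lintegral_const _

theorem card_mul_sqrt_pow_finrank_le {E : Type*} [NormedAddCommGroup E] [InnerProductSpace ℝ E]
    [FiniteDimensional ℝ E] {F : Finset E} {A q θ : ℝ} (hA : 0 < A) (hq₀ : 0 < q) (hq₁ : q < 1)
    (hθ₀ : 0 ≤ θ) (hθ₁ : θ < 1) {m K : ℕ} (hm : 4 * θ ≤ m ^ 2 * ((1 - θ) ^ 2 * ((1 - q) * q)))
    (hF : ∀ x ∈ F, ‖x‖ ^ 2 ≤ A) (hK : ∀ y, #{x ∈ F | ‖x - y‖ ^ 2 ≤ q * A} ≤ K) :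
    #F * √(θ * q) ^ finrank ℝ E ≤ (2 * m + 1) * K := by
  classical
  borelize E
  set μ : Measure E := volume
  set B : Set E := closedBall 0 √((1 - q) * A)
  have : 0 < 1 - q := sub_pos.mpr hq₁
  have hB₀ : μ B ≠ 0 := (measure_closedBall_pos μ 0 (by positivity)).ne'
  have hB : μ B ≠ ∞ := measure_closedBall_lt_top.ne
  have hball : μ (closedBall 0 √(θ * ((1 - q) * q * A))) =
      ENNReal.ofReal (√(θ * q) ^ finrank ℝ E) * μ B := by
    rw [← Measure.addHaar_closedBall_mul μ 0 (Real.sqrt_nonneg _) (Real.sqrt_nonneg _),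
      ← Real.sqrt_mul (by positivity)]
    congr 3
    ring
  have hmultiplicity : ∑ x ∈ F, μ (closedBall x √(q * A) ∩ B) ≤ K * μ B := by
    have h := sum_measure_le_mul_measure_univ (μ.restrict B) (F := F)
      (s := fun x => closedBall x √(q * A)) (K := K) (fun x _ => measurableSet_closedBall)
      fun y => ?_
    · simpa only [Measure.restrict_apply measurableSet_closedBall, Measure.restrict_apply_univ]
        using h
    · simpa only [mem_closedBall, dist_comm y, dist_eq_norm,
        Real.le_sqrt (norm_nonneg _) (mul_pos hq₀ hA).le] using hK y
  have hcount : #F * ENNReal.ofReal (√(θ * q) ^ finrank ℝ E) * μ B ≤ (2 * m + 1) * K * μ B := by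
    calc #F * ENNReal.ofReal (√(θ * q) ^ finrank ℝ E) * μ B
        = ∑ x ∈ F, μ (closedBall 0 √(θ * ((1 - q) * q * A))) := by
          rw [mul_assoc, ← hball, Finset.sum_const, nsmul_eq_mul]
      _ ≤ ∑ x ∈ F, (2 * m + 1) * μ (closedBall x √(q * A) ∩ B) := Finset.sum_le_sum fun x hx =>
          measure_closedBall_le_mul_lens μ hA hq₀ hq₁ hθ₀ hθ₁ hm (hF x hx)
      _ ≤ (2 * m + 1) * K * μ B := by
          rw [← Finset.mul_sum, mul_assoc]
          gcongr
  have hcount' := (ENNReal.mul_le_mul_iff_left hB₀ hB).mp hcount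
  rw [← ENNReal.ofReal_natCast, ← ENNReal.ofReal_mul (by positivity)] at hcount'
  exact_mod_cast (ENNReal.ofReal_le_natCast (n := (2 * m + 1) * K)).mp
    (by exact_mod_cast hcount')

theorem exists_card_le_mul_sqrt_pow {L : ℕ} (hL : 0 < L) {N P Q Q' : ℝ} (hQ' : 0 < Q')
    (hQ'Q : Q' < Q) (hQP : Q < P) (hN : ((L : ℝ) - 1) / L * Q < N) :
    ∃ D : ℝ, 0 < D ∧ ∀ n : ℕ, 0 < n → ∀ F : Finset (EuclideanSpace ℝ (Fin n)),
      (∀ x ∈ F, ‖x‖ ^ 2 ≤ n * P) → (∀ y, #{x ∈ F | ‖x - y‖ ^ 2 ≤ n * N} < L) →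
        #F ≤ D * √(P / Q') ^ n := by
  have hQ : 0 < Q := hQ'.trans hQ'Q
  have hP : 0 < P := hQ.trans hQP
  obtain ⟨K, hK₀, hK⟩ := exists_forall_card_le_of_card_filter_norm_sub_sq_le_lt hL hQ hN
  have hq₁ : Q / P < 1 := (div_lt_one hP).mpr hQP
  have hθ₁ : Q' / Q < 1 := (div_lt_one hQ).mpr hQ'Q
  obtain ⟨m, hm⟩ : ∃ m : ℕ,
      4 * (Q' / Q) ≤ m ^ 2 * ((1 - Q' / Q) ^ 2 * ((1 - Q / P) * (Q / P))) := by
    have hpos : 0 < (1 - Q' / Q) ^ 2 * ((1 - Q / P) * (Q / P)) := by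
      have := sub_pos.mpr hq₁
      have := sub_pos.mpr hθ₁
      positivity
    obtain ⟨m, hm⟩ := exists_nat_ge (4 * (Q' / Q) / ((1 - Q' / Q) ^ 2 * ((1 - Q / P) * (Q / P))))
    refine ⟨m, (div_le_iff₀ hpos).mp (hm.trans ?_)⟩
    exact_mod_cast Nat.le_self_pow two_ne_zero m
  refine ⟨(2 * m + 1) * K, by positivity, fun n hn F hF hFN => ?_⟩
  have hlocal (y : EuclideanSpace ℝ (Fin n)) : #{x ∈ F | ‖x - y‖ ^ 2 ≤ Q / P * (n * P)} ≤ K := by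
    have hQn : Q / P * (n * P) = n * Q := by field_simp
    rw [hQn]
    exact hK (Nat.cast_pos.mpr hn) (fun x hx => (Finset.mem_filter.mp hx).2) fun z =>
      (Finset.card_le_card (Finset.filter_subset_filter _ (Finset.filter_subset _ _))).trans_lt
        (hFN z)
  have hcard := card_mul_sqrt_pow_finrank_le (by positivity) (by positivity) hq₁ (by positivity) hθ₁
    hm hF hlocal
  rw [finrank_euclideanSpace_fin, div_mul_div_cancel₀ hQ.ne'] at hcard
  rwa [← inv_div, Real.sqrt_inv, inv_pow, ← div_eq_mul_inv, le_div_iff₀ (by positivity)]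

theorem IsListDecodable.mono {n L : ℕ} {P N : ℝ} {C C' : Set (EuclideanSpace ℝ (Fin n))}
    (hC : IsListDecodable L P N C) (hC' : C' ⊆ C) : IsListDecodable L P N C' :=
  ⟨hC'.trans hC.1, hC.2.trans_le (iInf_mono fun _ => iInf_mono' fun h => ⟨h.trans hC', le_rfl⟩)⟩

theorem IsListDecodable.card_filter_norm_sub_sq_le_lt {n L : ℕ} {P N : ℝ}
    {F : Finset (EuclideanSpace ℝ (Fin n))}
    (hF : IsListDecodable L P N (F : Set (EuclideanSpace ℝ (Fin n))))
    (y : EuclideanSpace ℝ (Fin n)) : #{x ∈ F | ‖x - y‖ ^ 2 ≤ n * N} < L := by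
  by_contra! hL
  obtain ⟨S, hSF, hS⟩ := Finset.exists_subset_card_eq hL
  refine hF.2.not_ge (iInf_le_of_le S <| iInf₂_le_of_le (hSF.trans (Finset.filter_subset _ _)) hS <|
    iInf_le_of_le y <| iSup₂_le fun x hx => ?_)
  exact EReal.coe_le_coe (Finset.mem_filter.mp (hSF hx)).2

theorem rate_le_of_forall_card_le {n : ℕ} {C : Set (EuclideanSpace ℝ (Fin n))} {M : ℝ} (hM : 0 < M)
    (hC : ∀ F : Finset (EuclideanSpace ℝ (Fin n)), ↑F ⊆ C → #F ≤ M) :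
    rate C ≤ ((Real.log M / n : ℝ) : EReal) := by
  have hencard : C.encard ≤ ⌊M⌋₊ := by
    by_contra! hlt
    obtain ⟨F, hFC, hF⟩ := Set.exists_subset_encard_eq (Order.add_one_le_of_lt hlt)
    lift F to Finset (EuclideanSpace ℝ (Fin n)) using Set.finite_of_encard_eq_coe hF
    rw [Set.encard_coe_eq_coe_finsetCard] at hF
    have hFM := Nat.le_floor (hC F hFC)
    have : #F = ⌊M⌋₊ + 1 := by exact_mod_cast hF
    lia
  have hlog : ENNReal.log (C.encard : ℝ≥0∞) ≤ (Real.log M : EReal) := by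
    rw [← ENNReal.log_ofReal_of_pos hM]
    refine ENNReal.log_le_log ?_
    calc (C.encard : ℝ≥0∞) ≤ ((⌊M⌋₊ : ℕ∞) : ℝ≥0∞) := by gcongr
      _ = ENNReal.ofReal ⌊M⌋₊ := by simp
      _ ≤ ENNReal.ofReal M := ENNReal.ofReal_le_ofReal (Nat.floor_le hM.le)
  rw [EReal.coe_div]
  exact EReal.div_le_div_right_of_nonneg (by positivity) hlog

theorem capacity_le_log_of_card_le_mul_pow {L : ℕ} {P N D s : ℝ} (hD : 0 < D) (hs : 0 < s)
    (h : ∀ᶠ n : ℕ in atTop, ∀ F : Finset (EuclideanSpace ℝ (Fin n)),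
      IsListDecodable L P N (F : Set (EuclideanSpace ℝ (Fin n))) → #F ≤ D * s ^ n) :
    capacity L P N ≤ (Real.log s : EReal) := by
  have hlim : Tendsto (fun n : ℕ => ((Real.log D / n + Real.log s : ℝ) : EReal)) atTop
      (𝓝 (Real.log s : EReal)) := by
    refine (continuous_coe_real_ereal.tendsto _).comp ?_
    simpa using (tendsto_const_div_atTop_nhds_zero_nat (Real.log D)).add_const (Real.log s)
  rw [← hlim.limsup_eq]
  refine limsup_le_limsup ?_
  filter_upwards [h, eventually_ne_atTop 0] with n hn hn₀
  refine iSup₂_le fun C hC => ?_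
  refine (rate_le_of_forall_card_le (M := D * s ^ n) (by positivity) fun F hF =>
    hn F (hC.mono hF)).trans_eq ?_
  rw [Real.log_mul hD.ne' (by positivity), Real.log_pow, add_div, mul_div_cancel_left₀]
  exact_mod_cast hn₀

theorem capacity_le_half_log {L : ℕ} (hL : 1 < L) {N P Q : ℝ} (hQ : 0 < Q) (hQP : Q ≤ P)
    (hN : ((L : ℝ) - 1) / L * Q ≤ N) :
    capacity L P N ≤ ((1 / 2 * Real.log (P / Q) : ℝ) : EReal) := by
  have hlim : Tendsto (fun Q' => ((1 / 2 * Real.log (P / Q') : ℝ) : EReal)) (𝓝[<] Q)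
      (𝓝 ((1 / 2 * Real.log (P / Q) : ℝ) : EReal)) := by
    have : ContinuousAt (fun Q' => 1 / 2 * Real.log (P / Q')) Q := by
      have := (div_pos (hQ.trans_le hQP) hQ).ne'
      fun_prop (disch := first | assumption | positivity)
    exact (continuous_coe_real_ereal.continuousAt.tendsto.comp this.tendsto).mono_left
      nhdsWithin_le_nhds
  refine ge_of_tendsto hlim ?_
  filter_upwards [Ioo_mem_nhdsLT hQ] with Q' ⟨hQ', hQ'Q⟩
  obtain ⟨Q₁, hQ'Q₁, hQ₁Q⟩ := exists_between hQ'Q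
  have hN₁ : ((L : ℝ) - 1) / L * Q₁ < N := by
    refine lt_of_lt_of_le ?_ hN
    have : 0 < (L : ℝ) - 1 := sub_pos.mpr (Nat.one_lt_cast.mpr hL)
    gcongr
  obtain ⟨D, hD, hcard⟩ := exists_card_le_mul_sqrt_pow hL.le hQ' hQ'Q₁ (hQ₁Q.trans_le hQP) hN₁
  have hP : 0 < P := hQ.trans_le hQP
  convert capacity_le_log_of_card_le_mul_pow (L := L) (P := P) (N := N) hD
    (s := √(P / Q')) (by positivity) ?_ using 2
  · rw [Real.log_sqrt (by positivity)]
    ring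
  · filter_upwards [eventually_gt_atTop 0] with n hn F hF
    refine hcard n hn F (fun x hx => ?_) hF.card_filter_norm_sub_sq_le_lt
    exact (Real.le_sqrt (norm_nonneg x) (by positivity)).mp (mem_closedBall_zero_iff.mp (hF.1 hx))

end MultiplePacking

theorem mainTheorem2 (L : ℕ) (hL : 2 ≤ L) (N P : ℝ) (hN : 0 < N) (hP : 0 < P)
    (hNP : N / P ≤ ((L : ℝ) - 1) / L) :
    MultiplePacking.capacity L P N ≤
      ((1 / 2 * Real.log (((L : ℝ) - 1) * P / (L * N)) : ℝ) : EReal) := by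
  have hL₂ : (2 : ℝ) ≤ L := by exact_mod_cast hL
  have hL₁ : 0 < (L : ℝ) - 1 := by linarith
  have hQP : L * N / (L - 1) ≤ P := by
    rw [div_le_div_iff₀ hP (by positivity)] at hNP
    rw [div_le_iff₀ hL₁]
    linarith
  have hcap := MultiplePacking.capacity_le_half_log (N := N) hL (by positivity) hQP
    (by field_simp; rfl)
  rwa [div_div_eq_mul_div, mul_comm P] at hcap
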